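/- Let $\mathcal X$ be a set of data points, $k\ge 2$ an integer and $\varepsilon_0>0$. Let $\mathcal R$ be an $\varepsilon_0$-locally differentially private mechanism on $\mathcal X$ with values in a countable discrete set $\mathcal Y$, i.e. $\Pr[\mathcal R(d)=y]\le e^{\varepsilon_0}\Pr[\mathcal R(d')=y]$ for all $d,d'\in\mathcal X$, $y\in\mathcal Y$. Let $\mathcal M_{sh}$ be the shuffle mechanism which maps a dataset $\mathcal D=(d_1,\dots,d_k)\in\mathcal X^k$ to a uniformly random permutation of the independent messages $\mathcal R(d_1),\dots,\mathcal R(d_k)$. A mechanism $\mathcal M$ on $\mathcal X^k$ with discrete output is called $\zeta$-ternary-$|\chi|^{\alpha}$-DP, where $\zeta:[1,\infty)\to[0,\infty)$, if for all real $\alpha\ge 1$ and all $\mathcal D,\mathcal D',\mathcal D''\in\mathcal X^k$ that agree except possibly in one common entry, $$\mathbb E_{h\sim\mathcal M(\mathcal D'')}\left[\left|\frac{\mathcal M(\mathcal D)(h)-\mathcal M(\mathcal D')(h)}{\mathcal M(\mathcal D'')(h)}\right|^{\alpha}\right]\le \zeta(\alpha)^{\alpha}$$ (the left side being understood as $\infty$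 if $\mathcal M(\mathcal D)(h)\neq\mathcal M(\mathcal D')(h)$ for some $h$ with $\mathcal M(\mathcal D'')(h)=0$). Then $\mathcal M_{sh}$ is $\zeta$-ternary-$|\chi|^{\alpha}$-DP for some function $\zeta$ which satisfies, for all real $\alpha\ge 2$, $$\zeta(\alpha)^{\alpha}\le\begin{cases}4\,\dfrac{(e^{\varepsilon_0}-1)^2}{\overline k\,e^{\varepsilon_0}}+(e^{\varepsilon_0}-e^{-\varepsilon_0})^{\alpha}\,e^{-\frac{k-1}{8e^{\varepsilon_0}}}&\text{if }\alpha=2,\\[2ex]\alpha\,\Gamma(\alpha/2)\left(\dfrac{2(e^{2\varepsilon_0}-1)^2}{\overline k\,e^{2\varepsilon_0}}\right)^{\alpha/2}+(e^{\varepsilon_0}-e^{-\varepsilon_0})^{\alpha}\,e^{-\frac{k-1}{8e^{\varepsilon_0}}}&\text{otherwise,}\end{cases}$$ where $\overline k=\left\lfloor\frac{k-1}{2e^{\varepsilon_0}}\right\rfloor+1$ and $\Gamma(z)=\int_0^\infty x^{z-1}e^{-x}\,dx$. -/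

import Mathlib

open scoped NNReal ENNReal

noncomputable section

namespace ShuffleDP

/-- A (discrete) local randomizer `R` with inputs in `X` and outputs in `Y` is
`ε₀`-locally differentially private. -/
def IsLDP {X Y : Type*} (ε₀ : ℝ) (R : X → PMF Y) : Prop :=
  ∀ (d d' : X) (y : Y), R d y ≤ ENNReal.ofReal (Real.exp ε₀) * R d' y

/-- The joint law of `k` independent samples, the `i`-th one drawn from `p i`. -/
def independent {Y : Type*} : {k : ℕ} → (Fin k → PMF Y) → PMF (Fin k → Y)
  | 0, _ => PMF.pure Fin.elim0
  | _ + 1, p => (p 0).bind fun y => (independent (Fin.tail p)).map fun ys => Fin.cons y ys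

/-- The joint law of independent samples has the product mass function. -/
theorem independent_apply {Y : Type*} {k : ℕ} (p : Fin k → PMF Y) (y : Fin k → Y) :
    independent p y = ∏ i, p i (y i) := by
  induction k with
  | zero =>
    have h : y = Fin.elim0 := Subsingleton.elim _ _
    subst h
    simp [independent]
  | succ k ih =>
    classical
    rw [Fin.prod_univ_succ]
    simp only [independent, PMF.bind_apply, PMF.map_apply]
    rw [tsum_eq_single (y 0)]
    · rw [tsum_eq_single (Fin.tail y)]
      · rw [if_pos (Fin.cons_self_tail y).symm, ih]
        rfl
      · intro ys hys
        rw [if_neg]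
        intro h
        apply hys
        rw [h, Fin.tail_cons]
    · intro a ha
      refine mul_eq_zero_of_right _ (ENNReal.tsum_eq_zero.2 fun ys => ?_)
      rw [if_neg]
      intro h
      apply ha
      rw [h, Fin.cons_zero]

/-- The shuffler: a uniformly random permutation of its `k` inputs. -/
def shuffler {Y : Type*} {k : ℕ} (y : Fin k → Y) : PMF (Fin k → Y) :=
  (PMF.uniformOfFintype (Equiv.Perm (Fin k))).map fun σ => y ∘ σ

/-- The shuffle mechanism: every client applies the local randomizer `R` to its data point,
independently of the others, and the `k` messages are then randomly permuted. -/
def shuffleMechanism {X Y : Type*} (R : X → PMF Y) (k : ℕ) (D : Fin k → X) :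
    PMF (Fin k → Y) :=
  (independent fun i => R (D i)).bind shuffler

/-- The ternary `|χ|^α`-divergence `𝔼_{h ∼ r} [|(p h - q h) / r h| ^ α]`.  As usual for
divergences, it is `∞` if `p` and `q` differ at a point which `r` does not charge. -/
def ternaryChiDiv {Z : Type*} (α : ℝ) (p q r : PMF Z) : ℝ≥0∞ :=
  ∑' h, open Classical in
    if r h = 0 ∧ p h ≠ q h then ⊤
    else r h * ENNReal.ofReal (|((p h).toReal - (q h).toReal) / (r h).toReal| ^ α)

/-- The three datasets are mutually neighbouring: they agree except possibly in one common
entry. -/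
def MutuallyAdjacent {X : Type*} {k : ℕ} (D D' D'' : Fin k → X) : Prop :=
  ∃ i, ∀ j, j ≠ i → D j = D' j ∧ D' j = D'' j

/-- The mechanism `M` is `ζ`-ternary-`|χ|^α`-differentially private. -/
def IsTernaryChiDP {X Z : Type*} {k : ℕ} (M : (Fin k → X) → PMF Z) (ζ : ℝ → ℝ≥0) : Prop :=
  ∀ α : ℝ, 1 ≤ α → ∀ D D' D'' : Fin k → X, MutuallyAdjacent D D' D'' →
    ternaryChiDiv α (M D) (M D') (M D'') ≤ ENNReal.ofReal ((ζ α : ℝ) ^ α)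

/-- `k̄ = ⌊(k - 1) / (2 e^ε₀)⌋ + 1`. -/
def kbar (k : ℕ) (ε₀ : ℝ) : ℕ :=
  ⌊((k : ℝ) - 1) / (2 * Real.exp ε₀)⌋₊ + 1

end ShuffleDP

end

/-!
Fix datasets `D`, `D'`, `D''` that agree off entry `i`, and put `r = R (D'' i)`, `q = exp (-ε₀)`.
By local privacy the law of every other message dominates `q • r`, so it is a mixture of `r` with
weight `q` and some other law (`exists_mixture`). Hence the output of the shuffle mechanism is a
mixture over the random set `S` of the clients that sample from `r`, whose size is binomial with
`k - 1` trials.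

Given `S`, the messages of `insert i S` are i.i.d. with law `r` under `D''`, while `D` and `D'` change
the law of message `i` only. Because of the shuffling, the position of message `i` may be averaged
over `insert i S` (`sum_perm_mul_prod_eq_average`). So relative to `D''` the difference of the two
output laws has density `(1 / (#S + 1)) ∑ X (y j)`, the sum over `j ∈ insert i S`, where
`X = (R (D i) - R (D' i)) / r` is the `ratio`. Convexity of `|·| ^ α` (`ternaryChiDiv_le_sum`) removes
the mixture over `S` and the shuffling, which yields
`IsLDP.ternaryChiDiv_shuffleMechanism_le_sum`: the divergence is at most the expectation over `S` of
the `α`-th absolute moment of an average of `#S + 1` independent copies of `X`.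

The variable `X` is centred, and bounded by `exp ε₀ - exp (-ε₀)`. For `α = 2` the moment is a variance
divided by `#S + 1` (`lintegral_sq_average_pi`, `IsLDP.integral_ratio_sq_le`); for other `α` the
average is sub-Gaussian by Hoeffding's lemma, and its moments follow by integrating the tail
(`lintegral_abs_rpow_average_pi_le`). Both bounds decrease in `#S`. They are used when `#S + 1` is at
least `kbar k ε₀`; the complementary event has probability at most
`exp (-(k - 1) / (8 exp ε₀))` by a Chernoff bound (`sum_powerset_card_le_half_mean`), and there `X` is
bounded trivially.
-/

namespace ShuffleDP

open MeasureTheory ProbabilityTheory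

/-! ### Moments of averages of independent variables -/

/-- Absolute moments of a sub-Gaussian variable: integrate the two-sided tail bound
`2 exp (-t² / (2v))` against `α t ^ (α - 1)`. -/
theorem _root_.ProbabilityTheory.HasSubgaussianMGF.lintegral_abs_rpow_le {Ω : Type*}
    {mΩ : MeasurableSpace Ω} {μ : Measure Ω} [IsProbabilityMeasure μ] {Z : Ω → ℝ} {v : ℝ≥0}
    (hZ : HasSubgaussianMGF Z v μ) (hv : 0 < v) {α : ℝ} (hα : 0 < α) :
    ∫⁻ ω, ENNReal.ofReal (|Z ω| ^ α) ∂μ ≤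
      ENNReal.ofReal (α * Real.Gamma (α / 2) * (2 * (v : ℝ)) ^ (α / 2)) := by
  have htail : ∀ t : ℝ, 0 < t →
      μ {ω | t ≤ |Z ω|} ≤ ENNReal.ofReal (2 * Real.exp (-(1 / (2 * v)) * t ^ (2 : ℝ))) := by
    intro t ht
    have hsub : {ω | t ≤ |Z ω|} ⊆ {ω | t ≤ Z ω} ∪ {ω | t ≤ (-Z) ω} := by
      intro ω hω
      simpa [le_abs] using hω
    have h1 := hZ.measure_ge_le ht.le
    have h2 := hZ.neg.measure_ge_le ht.le
    have he : -t ^ 2 / (2 * (v : ℝ)) = -(1 / (2 * v)) * t ^ (2 : ℝ) := by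
      rw [Real.rpow_two]; ring
    rw [he] at h1 h2
    rw [two_mul, ENNReal.ofReal_add (Real.exp_nonneg _) (Real.exp_nonneg _)]
    refine (measure_mono hsub).trans ((measure_union_le _ _).trans (add_le_add ?_ ?_))
    · exact (ofReal_measureReal (μ := μ)).symm.trans_le (ENNReal.ofReal_le_ofReal h1)
    · exact (ofReal_measureReal (μ := μ)).symm.trans_le (ENNReal.ofReal_le_ofReal h2)
  have hb : 0 < 1 / (2 * (v : ℝ)) := by positivity
  have hint := integral_rpow_mul_exp_neg_mul_rpow (p := 2) (q := α - 1) (b := 1 / (2 * v))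
    two_pos (by linarith) hb
  have hpos : 0 < (1 / (2 * (v : ℝ))) ^ (-(α - 1 + 1) / 2) * (1 / 2)
      * Real.Gamma ((α - 1 + 1) / 2) := by
    have : 0 < Real.Gamma ((α - 1 + 1) / 2) := Real.Gamma_pos_of_pos (by linarith)
    positivity
  have hintg : IntegrableOn (fun x : ℝ ↦ x ^ (α - 1) * Real.exp (-(1 / (2 * v)) * x ^ (2 : ℝ)))
      (Set.Ioi 0) := .of_integral_ne_zero (by rw [hint]; exact hpos.ne')
  rw [lintegral_rpow_eq_lintegral_meas_le_mul μ (Filter.Eventually.of_forall fun _ ↦ abs_nonneg _)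
    hZ.aemeasurable.abs hα]
  calc ENNReal.ofReal α * ∫⁻ t in Set.Ioi 0, μ {ω | t ≤ |Z ω|} * ENNReal.ofReal (t ^ (α - 1))
      ≤ ENNReal.ofReal α * ∫⁻ t in Set.Ioi 0, ENNReal.ofReal
          (2 * (t ^ (α - 1) * Real.exp (-(1 / (2 * v)) * t ^ (2 : ℝ)))) := by
        gcongr ENNReal.ofReal α * ?_
        refine setLIntegral_mono' measurableSet_Ioi fun t ht ↦ ?_
        refine (mul_le_mul_left (htail t ht) _).trans_eq ?_
        rw [← ENNReal.ofReal_mul (by positivity)]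
        ring_nf
    _ = ENNReal.ofReal (α * (2 * ((1 / (2 * (v : ℝ))) ^ (-(α - 1 + 1) / 2) * (1 / 2)
          * Real.Gamma ((α - 1 + 1) / 2)))) := by
        rw [ENNReal.ofReal_mul hα.le, ← hint, ← integral_const_mul,
          ofReal_integral_eq_lintegral_ofReal (hintg.const_mul 2)]
        filter_upwards [ae_restrict_mem measurableSet_Ioi] with t ht
        have : (0 : ℝ) < t := ht
        positivity
    _ = _ := by
        congr 1
        rw [one_div, Real.inv_rpow (by positivity), ← Real.rpow_neg (by positivity)]
        ring_nf

section Average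

variable {ι Y : Type*} [Fintype ι] [MeasurableSpace Y] {ν : ι → Measure Y}
  [∀ j, IsProbabilityMeasure (ν j)] {ρ : Measure Y} {T : Finset ι} {X : Y → ℝ}

theorem integral_sum_pi_eq_zero (hT : ∀ j ∈ T, ν j = ρ) (hX : Integrable X ρ)
    (h0 : ∫ y, X y ∂ρ = 0) : ∫ y, ∑ j ∈ T, X (y j) ∂(Measure.pi ν) = 0 := by
  rw [integral_finsetSum]
  · refine Finset.sum_eq_zero fun j hj ↦ ?_
    rw [integral_comp_eval (by rw [hT j hj]; exact hX.aestronglyMeasurable), hT j hj, h0]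
  · intro j hj
    exact integrable_comp_eval (by rwa [hT j hj])

/-- The variance of an average of independent copies of a centred variable `X`.  The
coordinates outside `T` may have arbitrary laws. -/
theorem lintegral_sq_average_pi (hT : ∀ j ∈ T, ν j = ρ) (hTn : T.Nonempty) (hX : MemLp X 2 ρ)
    (hXm : Measurable X) (h0 : ∫ y, X y ∂ρ = 0) :
    ∫⁻ y, ENNReal.ofReal (((∑ j ∈ T, X (y j)) / T.card) ^ 2) ∂(Measure.pi ν) =
      ENNReal.ofReal ((∫ y, X y ^ 2 ∂ρ) / T.card) := by
  have hρ : IsProbabilityMeasure ρ := by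
    obtain ⟨j, hj⟩ := hTn
    rw [← hT j hj]; infer_instance
  have hn : (T.card : ℝ) ≠ 0 := by simpa using hTn.ne_empty
  have hL : ∀ j ∈ T, MemLp (fun y : ι → Y ↦ X (y j)) 2 (Measure.pi ν) := fun j hj ↦
    MemLp.comp_measurePreserving (g := X) (by rwa [hT j hj]) (measurePreserving_eval ν j)
  have hi : iIndepFun (fun j (y : ι → Y) ↦ X (y j)) (Measure.pi ν) :=
    iIndepFun_pi (fun _ ↦ hXm.aemeasurable)
  have hvar := IndepFun.variance_sum hL fun a _ b _ hab ↦ hi.indepFun hab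
  have hv1 : ∀ j ∈ T, variance (fun y : ι → Y ↦ X (y j)) (Measure.pi ν) = ∫ y, X y ^ 2 ∂ρ := by
    intro j hj
    rw [variance_of_integral_eq_zero (hL j hj).aemeasurable
      (by rw [integral_comp_eval (by rw [hT j hj]; exact hX.aestronglyMeasurable), hT j hj, h0])]
    rw [← hT j hj]
    exact integral_comp_eval (μ := ν) (i := j) (f := fun y ↦ X y ^ 2)
      (hXm.pow_const 2).aestronglyMeasurable
  rw [Finset.sum_congr rfl hv1, variance_of_integral_eq_zero] at hvar
  rotate_left
  · fun_prop
  · simpa using integral_sum_pi_eq_zero hT (hX.integrable (by norm_num)) h0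
  have hL2 : MemLp (∑ j ∈ T, fun y : ι → Y ↦ X (y j)) 2 (Measure.pi ν) := memLp_finsetSum' _ hL
  rw [← ofReal_integral_eq_lintegral_ofReal]
  · congr 1
    simp only [div_pow]
    rw [integral_div]
    simp only [Finset.sum_apply, Finset.sum_const, nsmul_eq_mul] at hvar
    rw [hvar]
    field_simp
  · simp only [div_pow]
    simpa using hL2.integrable_sq.div_const ((T.card : ℝ) ^ 2)
  · exact Filter.Eventually.of_forall fun _ ↦ sq_nonneg _

/-- Moments of an average of independent copies of a centred variable bounded by `c`: by
Hoeffding's lemma the average is sub-Gaussian with variance proxy `c² / #T`. -/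
theorem lintegral_abs_rpow_average_pi_le (hT : ∀ j ∈ T, ν j = ρ) (hTn : T.Nonempty)
    (hXm : Measurable X) {c : ℝ} (hc : 0 < c) (hXc : ∀ y, |X y| ≤ c) (h0 : ∫ y, X y ∂ρ = 0)
    {α : ℝ} (hα : 0 < α) :
    ∫⁻ y, ENNReal.ofReal (|(∑ j ∈ T, X (y j)) / T.card| ^ α) ∂(Measure.pi ν) ≤
      ENNReal.ofReal (α * Real.Gamma (α / 2) * (2 * c ^ 2 / T.card) ^ (α / 2)) := by
  have hn : (0 : ℝ) < T.card := by simpa using hTn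
  have hsub : ∀ j ∈ T, HasSubgaussianMGF (fun y : ι → Y ↦ X (y j)) ((‖c - -c‖₊ / 2) ^ 2)
      (Measure.pi ν) := fun j hj ↦
    hasSubgaussianMGF_of_mem_Icc_of_integral_eq_zero (hXm.comp (measurable_pi_apply j)).aemeasurable
      (Filter.Eventually.of_forall fun y ↦ abs_le.1 (hXc _))
      (by rw [integral_comp_eval hXm.aestronglyMeasurable, hT j hj, h0])
  have hi : iIndepFun (fun j (y : ι → Y) ↦ X (y j)) (Measure.pi ν) :=
    iIndepFun_pi (fun _ ↦ hXm.aemeasurable)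
  obtain ⟨v, hv, hval⟩ : ∃ v : ℝ≥0, HasSubgaussianMGF
      (fun y : ι → Y ↦ (T.card : ℝ)⁻¹ * ∑ j ∈ T, X (y j)) v (Measure.pi ν) ∧
        (v : ℝ) = c ^ 2 / T.card := by
    refine ⟨_, (HasSubgaussianMGF.sum_of_iIndepFun hi hsub).const_mul ((T.card : ℝ)⁻¹), ?_⟩
    change ((T.card : ℝ)⁻¹) ^ 2 * ((∑ _j ∈ T, (‖c - -c‖₊ / 2) ^ 2 : ℝ≥0) : ℝ) = _
    simp only [Finset.sum_const, nsmul_eq_mul]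
    push_cast
    rw [Real.norm_eq_abs, abs_of_pos (by linarith)]
    field_simp
    ring
  have := hv.lintegral_abs_rpow_le (by rw [← NNReal.coe_pos, hval]; positivity) hα
  rw [hval] at this
  convert this using 5
  · rw [div_eq_inv_mul]
  · ring

end Average

/-! ### The mass function of the shuffle mechanism -/

theorem shuffleMechanism_apply {X Y : Type*} (R : X → PMF Y) (k : ℕ) (D : Fin k → X)
    (h : Fin k → Y) :
    shuffleMechanism R k D h =
      (k.factorial : ℝ≥0∞)⁻¹ * ∑ σ : Equiv.Perm (Fin k), ∏ j, R (D j) (h (σ j)) := by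
  classical
  have hsh : ∀ y : Fin k → Y, shuffler y h =
      ∑ σ : Equiv.Perm (Fin k), if y = h ∘ σ then (k.factorial : ℝ≥0∞)⁻¹ else 0 := by
    intro y
    -- In the definition of `shuffler` permutations are coerced to functions through the monad.
    have hmap : shuffler y = (PMF.uniformOfFintype (Equiv.Perm (Fin k))).map
        fun σ : Equiv.Perm (Fin k) ↦ y ∘ ⇑σ :=
      PMF.map_comp (fun σ : Equiv.Perm (Fin k) ↦ (σ : Fin k → Fin k)) _ (y ∘ ·)
    rw [hmap, PMF.map_apply, tsum_fintype]
    refine Fintype.sum_equiv (Equiv.inv (Equiv.Perm (Fin k))) _ _ fun σ ↦ ?_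
    rw [PMF.uniformOfFintype_apply, Fintype.card_perm, Fintype.card_fin]
    have hiff : h = y ∘ ⇑σ ↔ y = h ∘ ⇑(Equiv.inv (Equiv.Perm (Fin k)) σ) := by
      constructor
      all_goals
        rintro rfl
        ext j
        simp
    by_cases hc : h = y ∘ ⇑σ
    · rw [if_pos hc, if_pos (hiff.1 hc)]
    · rw [if_neg hc, if_neg fun h' ↦ hc (hiff.2 h')]
  simp only [shuffleMechanism, PMF.bind_apply, hsh, independent_apply, Finset.mul_sum]
  rw [Summable.tsum_finsetSum fun _ _ ↦ ENNReal.summable]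
  refine Finset.sum_congr rfl fun σ _ ↦ ?_
  rw [tsum_eq_single (h ∘ σ) fun y hy ↦ by rw [if_neg hy, mul_zero], if_pos rfl, mul_comm]
  rfl

/-- A law that dominates `q • r` is a mixture of `r`, with weight `q`, and some other law. -/
theorem exists_mixture {Y : Type*} (p r : PMF Y) {q : ℝ≥0∞} (hq : q < 1)
    (h : ∀ y, q * r y ≤ p y) : ∃ s : PMF Y, ∀ y, p y = q * r y + (1 - q) * s y := by
  have h1 : 1 - q ≠ 0 := (tsub_pos_of_lt hq).ne'
  have h2 : 1 - q ≠ ⊤ := by finiteness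
  have hsum : ∑' y, (p y - q * r y) = 1 - q := by
    have : ∑' y, (p y - q * r y) + q = 1 := by
      have hqr : ∑' y, q * r y = q := by rw [ENNReal.tsum_mul_left, r.tsum_coe, mul_one]
      nth_rewrite 2 [← hqr]
      rw [← ENNReal.tsum_add, ← p.tsum_coe]
      exact tsum_congr fun y ↦ tsub_add_cancel_of_le (h y)
    exact ENNReal.eq_sub_of_add_eq hq.ne_top this
  refine ⟨⟨fun y ↦ (1 - q)⁻¹ * (p y - q * r y), ?_⟩, fun y ↦ ?_⟩
  · rw [ENNReal.summable.hasSum_iff, ENNReal.tsum_mul_left, hsum, ENNReal.inv_mul_cancel h1 h2]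
  · change p y = q * r y + (1 - q) * ((1 - q)⁻¹ * (p y - q * r y))
    rw [← mul_assoc, ENNReal.mul_inv_cancel h1 h2, one_mul, add_tsub_cancel_of_le (h y)]

/-! ### Convexity and symmetrization -/

/-- Jensen's inequality for `|·| ^ α` with unnormalized weights; if they are all zero, both sides
vanish because `0 * _ = 0`. -/
theorem sum_mul_abs_div_rpow_le {κ : Type*} (s : Finset κ) (w x : κ → ℝ) (hw : ∀ i ∈ s, 0 ≤ w i)
    {α : ℝ} (hα : 1 ≤ α) :
    (∑ i ∈ s, w i) * |(∑ i ∈ s, w i * x i) / ∑ i ∈ s, w i| ^ α ≤ ∑ i ∈ s, w i * |x i| ^ α := by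
  rcases (Finset.sum_nonneg hw).eq_or_lt with h0 | h0
  · rw [← h0, zero_mul]
    exact Finset.sum_nonneg fun i hi ↦ mul_nonneg (hw i hi) (by positivity)
  set W := ∑ i ∈ s, w i with hW
  have hJ := Real.rpow_arith_mean_le_arith_mean_rpow s (fun i ↦ w i / W) (fun i ↦ |x i|)
    (fun i hi ↦ div_nonneg (hw i hi) h0.le) (by rw [← Finset.sum_div, ← hW, div_self h0.ne'])
    (fun i _ ↦ abs_nonneg _) hα
  have habs : |(∑ i ∈ s, w i * x i) / W| ≤ ∑ i ∈ s, w i / W * |x i| := by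
    rw [Finset.sum_div]
    refine (Finset.abs_sum_le_sum_abs _ _).trans (Finset.sum_le_sum fun i hi ↦ ?_)
    rw [abs_div, abs_mul, abs_of_nonneg (hw i hi), abs_of_pos h0, div_mul_eq_mul_div]
  calc W * |(∑ i ∈ s, w i * x i) / W| ^ α
      ≤ W * ∑ i ∈ s, w i / W * |x i| ^ α := by
        gcongr
        exact (Real.rpow_le_rpow (abs_nonneg _) habs (by linarith)).trans hJ
    _ = ∑ i ∈ s, w i * |x i| ^ α := by
        rw [Finset.mul_sum]
        refine Finset.sum_congr rfl fun i _ ↦ ?_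
        field_simp

/-- Joint convexity of the ternary divergence: if `r` is a finite sum of nonnegative `w i`, and
`p - q` is the sum of the `w i` with densities `x i`, then the divergence is at most the sum of the
`α`-th absolute moments of the `x i` under the `w i`. -/
theorem ternaryChiDiv_le_sum {Z κ : Type*} (s : Finset κ) (p q r : PMF Z) (w x : κ → Z → ℝ)
    (hw : ∀ i z, 0 ≤ w i z) (hr : ∀ z, (r z).toReal = ∑ i ∈ s, w i z)
    (hpq : ∀ z, (p z).toReal - (q z).toReal = ∑ i ∈ s, w i z * x i z) {α : ℝ} (hα : 1 ≤ α) :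
    ternaryChiDiv α p q r ≤ ∑ i ∈ s, ∑' z, ENNReal.ofReal (w i z * |x i z| ^ α) := by
  rw [← Summable.tsum_finsetSum fun _ _ ↦ ENNReal.summable]
  refine ENNReal.tsum_le_tsum fun z ↦ ?_
  rw [if_neg]
  · rw [← ENNReal.ofReal_toReal (r.apply_ne_top z), ← ENNReal.ofReal_mul ENNReal.toReal_nonneg,
      ENNReal.toReal_ofReal ENNReal.toReal_nonneg, ← ENNReal.ofReal_sum_of_nonneg]
    · rw [hpq, hr]
      exact ENNReal.ofReal_le_ofReal (sum_mul_abs_div_rpow_le s _ _ (fun i _ ↦ hw i z) hα)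
    · exact fun i _ ↦ mul_nonneg (hw i z) (by positivity)
  · rintro ⟨h0, hne⟩
    apply hne
    have h1 := hr z
    rw [h0, ENNReal.toReal_zero, eq_comm, Finset.sum_eq_zero_iff_of_nonneg fun i _ ↦ hw i z] at h1
    rw [← ENNReal.toReal_eq_toReal_iff' (p.apply_ne_top z) (q.apply_ne_top z), ← sub_eq_zero, hpq]
    exact Finset.sum_eq_zero fun i hi ↦ by rw [h1 i hi, zero_mul]

/-- If the mass functions `m j`, `j ∈ T`, coincide, then after summation over all permutations the
value of `X` at position `i ∈ T` may be replaced by its average over the positions in `T`: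
precomposing `σ` with the transposition of `i` and `j ∈ T` leaves the product unchanged. -/
theorem sum_perm_mul_prod_eq_average {Y : Type*} {k : ℕ} (m : Fin k → Y → ℝ) (T : Finset (Fin k))
    {i : Fin k} (hi : i ∈ T) (hT : ∀ j ∈ T, m j = m i) (X : Y → ℝ) (h : Fin k → Y) :
    ∑ σ : Equiv.Perm (Fin k), (∏ j, m j (h (σ j))) * X (h (σ i)) =
      ∑ σ : Equiv.Perm (Fin k),
        (∏ j, m j (h (σ j))) * ((∑ j ∈ T, X (h (σ j))) / T.card) := by
  classical
  have hswap : ∀ l ∈ T, ∑ σ : Equiv.Perm (Fin k), (∏ j, m j (h (σ j))) * X (h (σ l)) =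
      ∑ σ : Equiv.Perm (Fin k), (∏ j, m j (h (σ j))) * X (h (σ i)) := by
    intro l hl
    refine Fintype.sum_equiv (Equiv.mulRight (Equiv.swap i l)) _ _ fun σ ↦ ?_
    simp only [Equiv.coe_mulRight, Equiv.Perm.coe_mul, Function.comp_apply, Equiv.swap_apply_left]
    congr 1
    refine Fintype.prod_equiv (Equiv.swap i l) _ _ fun j ↦ ?_
    rw [Equiv.swap_apply_self]
    refine congrFun ?_ _
    rcases eq_or_ne j i with rfl | hji
    · rw [Equiv.swap_apply_left, hT l hl]
    rcases eq_or_ne j l with rfl | hjl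
    · rw [Equiv.swap_apply_right, hT j hl]
    · rw [Equiv.swap_apply_of_ne_of_ne hji hjl]
  have hn : (T.card : ℝ) ≠ 0 := by simpa using Finset.ne_empty_of_mem hi
  simp only [← mul_div_assoc, Finset.mul_sum]
  rw [← Finset.sum_div, Finset.sum_comm, Finset.sum_congr rfl hswap, Finset.sum_const, nsmul_eq_mul,
    mul_div_cancel_left₀ _ hn]

/-! ### Product laws and a binomial lower tail -/

theorem tsum_prod_mul_eq_lintegral {ι Y : Type*} [Fintype ι] [Countable Y] [MeasurableSpace Y]
    [MeasurableSingletonClass Y] (μ : ι → PMF Y) (f : (ι → Y) → ℝ) :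
    ∑' y : ι → Y, ENNReal.ofReal ((∏ j, (μ j (y j)).toReal) * f y) =
      ∫⁻ y, ENNReal.ofReal (f y) ∂(Measure.pi fun j ↦ (μ j).toMeasure) := by
  rw [lintegral_countable']
  refine tsum_congr fun y ↦ ?_
  rw [Measure.pi_singleton, mul_comm, ENNReal.ofReal_mul' (by positivity),
    ENNReal.ofReal_prod_of_nonneg fun _ _ ↦ ENNReal.toReal_nonneg]
  congr 1
  refine Finset.prod_congr rfl fun j _ ↦ ?_
  rw [PMF.toMeasure_apply_singleton _ _ (measurableSet_singleton _),
    ENNReal.ofReal_toReal ((μ j).apply_ne_top _)]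

/-- A Chernoff bound: a binomial variable with `#A` trials of probability `q` is at most half its
mean with probability at most `exp (-#A q / 8)`. -/
theorem sum_powerset_card_le_half_mean {ι : Type*} (A : Finset ι) {q : ℝ} (hq0 : 0 ≤ q)
    (hq1 : q ≤ 1) :
    ∑ S ∈ A.powerset with (S.card : ℝ) ≤ A.card * q / 2,
      q ^ S.card * (1 - q) ^ (A.card - S.card) ≤ Real.exp (-(A.card * q / 8)) := by
  have hlog : Real.log 2 ≤ 3 / 4 := by linarith [Real.log_two_lt_d9]
  -- On the event `#S ≤ #A q / 2` the factor `2 ^ (#A q / 2 - #S)` is at least `1`.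
  calc ∑ S ∈ A.powerset with (S.card : ℝ) ≤ A.card * q / 2,
        q ^ S.card * (1 - q) ^ (A.card - S.card)
      ≤ ∑ S ∈ A.powerset, (2 : ℝ) ^ (A.card * q / 2) *
          ((q / 2) ^ S.card * (1 - q) ^ (A.card - S.card)) := by
        have h1q : 0 ≤ 1 - q := by linarith
        rw [Finset.sum_filter]
        refine Finset.sum_le_sum fun S _ ↦ ?_
        split_ifs with hS
        · have : (2 : ℝ) ^ S.card ≤ 2 ^ (A.card * q / 2) := by
            rw [← Real.rpow_natCast]
            exact Real.rpow_le_rpow_of_exponent_le one_le_two hS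
          calc q ^ S.card * (1 - q) ^ (A.card - S.card)
              = (2 : ℝ) ^ S.card * ((q / 2) ^ S.card * (1 - q) ^ (A.card - S.card)) := by
                rw [div_pow]; field_simp
            _ ≤ _ := by gcongr
        · positivity
    _ = (2 : ℝ) ^ (A.card * q / 2) * (1 - q / 2) ^ A.card := by
        rw [← Finset.mul_sum, Finset.sum_pow_mul_eq_add_pow]
        ring_nf
    _ ≤ Real.exp (Real.log 2 * (A.card * q / 2)) * Real.exp (-(q / 2)) ^ A.card := by
        rw [Real.rpow_def_of_pos two_pos]
        gcongr
        · linarith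
        · linarith [Real.add_one_le_exp (-(q / 2))]
    -- The exponent is `-(1 - log 2) / 2` times the mean, and `log 2 ≤ 3 / 4`.
    _ ≤ Real.exp (-(A.card * q / 8)) := by
        rw [← Real.exp_nat_mul, ← Real.exp_add]
        apply Real.exp_le_exp.2
        have : 0 ≤ A.card * q := by positivity
        nlinarith

theorem hasSum_toReal {Y : Type*} (p : PMF Y) : HasSum (fun y ↦ (p y).toReal) 1 := by
  have := ENNReal.hasSum_toReal (f := p) (by rw [p.tsum_coe]; exact ENNReal.one_ne_top)
  rwa [← ENNReal.tsum_toReal_eq p.apply_ne_top, p.tsum_coe, ENNReal.toReal_one] at this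

/-! ### Ratios of locally private laws -/

section LocalRatio

variable {Y : Type*} {ε : ℝ}

theorem IsLDP.toReal_le {X : Type*} {R : X → PMF Y} (hR : IsLDP ε R) (d d' : X) (y : Y) :
    (R d y).toReal ≤ Real.exp ε * (R d' y).toReal := by
  have := ENNReal.toReal_mono (ENNReal.mul_ne_top ENNReal.ofReal_ne_top ((R d').apply_ne_top y)) (hR d d' y)
  rwa [ENNReal.toReal_mul, ENNReal.toReal_ofReal (Real.exp_nonneg _)] at this

theorem IsLDP.exp_neg_mul_le {X : Type*} {R : X → PMF Y} (hR : IsLDP ε R) (d d' : X) (y : Y) :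
    Real.exp (-ε) * (R d y).toReal ≤ (R d' y).toReal := by
  rw [Real.exp_neg, inv_mul_le_iff₀ (Real.exp_pos _)]
  exact hR.toReal_le d d' y

/-- The density `(p - p') / r` of the difference of two laws with respect to a third one.  It is
`0` where `r` vanishes, which does no harm when the three laws have the same support. -/
noncomputable def ratio (p p' r : PMF Y) (y : Y) : ℝ := ((p y).toReal - (p' y).toReal) / (r y).toReal

variable {X : Type*} {R : X → PMF Y}

theorem IsLDP.mul_ratio (hR : IsLDP ε R) (d d' d'' : X) (y : Y) :
    (R d'' y).toReal * ratio (R d) (R d') (R d'') y = (R d y).toReal - (R d' y).toReal := by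
  rcases eq_or_ne (R d'' y).toReal 0 with h0 | h0
  · have h1 := hR.toReal_le d d'' y
    have h2 := hR.toReal_le d' d'' y
    rw [h0, mul_zero] at h1 h2
    rw [h0, zero_mul, le_antisymm h1 ENNReal.toReal_nonneg,
      le_antisymm h2 ENNReal.toReal_nonneg, sub_zero]
  · exact mul_div_cancel₀ _ h0

theorem IsLDP.abs_ratio_le (hR : IsLDP ε R) (hε : 0 ≤ ε) (d d' d'' : X) (y : Y) :
    |ratio (R d) (R d') (R d'') y| ≤ Real.exp ε - Real.exp (-ε) := by
  have hc : 0 ≤ Real.exp ε - Real.exp (-ε) :=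
    sub_nonneg.2 (Real.exp_le_exp.2 (by linarith))
  rw [ratio, abs_div, abs_of_nonneg (ENNReal.toReal_nonneg (a := R d'' y))]
  refine div_le_of_le_mul₀ ENNReal.toReal_nonneg hc ?_
  rw [abs_le]
  have h1 := hR.toReal_le d d'' y
  have h2 := hR.toReal_le d' d'' y
  have h3 := hR.exp_neg_mul_le d'' d y
  have h4 := hR.exp_neg_mul_le d'' d' y
  constructor <;> linarith

/-- Summing this bound over `y` bounds the second moment of the ratio.  It follows from
`(a - r)² ≤ (exp ε + exp (-ε) - 2) a r`, valid when `a / r` lies between `exp (-ε)` and `exp ε`,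
applied to both laws. -/
theorem IsLDP.mul_ratio_sq_le (hR : IsLDP ε R) (d d' d'' : X) (y : Y) :
    (R d'' y).toReal * ratio (R d) (R d') (R d'') y ^ 2 ≤
      2 * ((Real.exp ε - 1) ^ 2 / Real.exp ε) * ((R d y).toReal + (R d' y).toReal) := by
  -- Expand `0 ≤ (exp ε * r - a) * (a - exp (-ε) * r)`.
  have key : ∀ a r : ℝ, 0 ≤ r → a ≤ Real.exp ε * r → Real.exp (-ε) * r ≤ a →
      (a - r) ^ 2 ≤ (Real.exp ε - 1) ^ 2 / Real.exp ε * a * r := by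
    intro a r _ h1 h2
    have h3 := mul_nonneg (sub_nonneg.2 h1) (sub_nonneg.2 h2)
    have he : Real.exp ε * Real.exp (-ε) = 1 := by rw [← Real.exp_add]; simp
    have hw : (Real.exp ε - 1) ^ 2 / Real.exp ε = Real.exp ε + Real.exp (-ε) - 2 := by
      rw [Real.exp_neg]
      field_simp
      ring
    rw [hw]
    linear_combination h3 - r ^ 2 * he
  set w := (Real.exp ε - 1) ^ 2 / Real.exp ε with hw
  have hw0 : 0 ≤ w := by positivity
  have hr : 0 ≤ (R d'' y).toReal := ENNReal.toReal_nonneg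
  rcases hr.eq_or_lt with h0 | h0
  · rw [← h0, zero_mul]
    positivity
  have k1 := key _ _ hr (hR.toReal_le d d'' y) (hR.exp_neg_mul_le d'' d y)
  have k2 := key _ _ hr (hR.toReal_le d' d'' y) (hR.exp_neg_mul_le d'' d' y)
  have hsq : (R d'' y).toReal * ratio (R d) (R d') (R d'') y ^ 2 =
      ((R d y).toReal - (R d' y).toReal) ^ 2 / (R d'' y).toReal := by
    rw [ratio]
    field_simp
  rw [hsq, div_le_iff₀ h0]
  nlinarith [sq_nonneg ((R d y).toReal + (R d' y).toReal - 2 * (R d'' y).toReal)]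

variable [Countable Y] [MeasurableSpace Y] [MeasurableSingletonClass Y]

theorem IsLDP.memLp_ratio (hR : IsLDP ε R) (hε : 0 ≤ ε) (d d' d'' : X) :
    MemLp (ratio (R d) (R d') (R d'')) 2 (R d'').toMeasure :=
  MemLp.of_bound (measurable_of_countable _).aestronglyMeasurable _
    (Filter.Eventually.of_forall fun y ↦ hR.abs_ratio_le hε d d' d'' y)

theorem IsLDP.integral_ratio (hR : IsLDP ε R) (hε : 0 ≤ ε) (d d' d'' : X) :
    ∫ y, ratio (R d) (R d') (R d'') y ∂(R d'').toMeasure = 0 := by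
  rw [PMF.integral_eq_tsum _ _ ((hR.memLp_ratio hε d d' d'').integrable (by norm_num))]
  simp only [smul_eq_mul, hR.mul_ratio]
  rw [((hasSum_toReal (R d)).sub (hasSum_toReal (R d'))).tsum_eq, sub_self]

theorem IsLDP.integral_ratio_sq_le (hR : IsLDP ε R) (hε : 0 ≤ ε) (d d' d'' : X) :
    ∫ y, ratio (R d) (R d') (R d'') y ^ 2 ∂(R d'').toMeasure ≤
      4 * ((Real.exp ε - 1) ^ 2 / Real.exp ε) := by
  rw [PMF.integral_eq_tsum _ _ (hR.memLp_ratio hε d d' d'').integrable_sq]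
  have hs := ((hasSum_toReal (R d)).add (hasSum_toReal (R d'))).mul_left
    (2 * ((Real.exp ε - 1) ^ 2 / Real.exp ε))
  simp only [smul_eq_mul]
  refine (Summable.tsum_le_tsum (hR.mul_ratio_sq_le d d' d'') ?_ hs.summable).trans_eq ?_
  · exact Summable.of_nonneg_of_le
      (fun y ↦ mul_nonneg ENNReal.toReal_nonneg (sq_nonneg _)) (hR.mul_ratio_sq_le d d' d'')
      hs.summable
  · rw [hs.tsum_eq]
    ring

end LocalRatio

/-! ### Reduction to averages of independent ratios -/

/-- The reduction step.  Every client `j ≠ i` samples from `R (D'' i)` with probability `exp (-ε)`,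
and `S` is the set of those who do; given `S`, the divergence is at most the `α`-th moment of the
average of the ratio over the messages of `insert i S`, which are independent with law
`R (D'' i)`.  The laws `μ S j` are those of the messages given `S`. -/
theorem IsLDP.ternaryChiDiv_shuffleMechanism_le_sum {X Y : Type*} {k : ℕ} {ε : ℝ} (hε : 0 < ε)
    {R : X → PMF Y} (hR : IsLDP ε R) {D D' D'' : Fin k → X} {i : Fin k}
    (hD : ∀ j, j ≠ i → D j = D' j ∧ D' j = D'' j) :
    ∃ μ : Finset (Fin k) → Fin k → PMF Y, (∀ S, ∀ j ∈ insert i S, μ S j = R (D'' i)) ∧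
      ∀ α : ℝ, 1 ≤ α → ternaryChiDiv α (shuffleMechanism R k D) (shuffleMechanism R k D')
          (shuffleMechanism R k D'') ≤
        ∑ S ∈ (Finset.univ.erase i).powerset,
          ENNReal.ofReal (Real.exp (-ε) ^ S.card * (1 - Real.exp (-ε)) ^ (k - 1 - S.card)) *
            ∑' y : Fin k → Y, ENNReal.ofReal ((∏ j, (μ S j (y j)).toReal) *
              |(∑ j ∈ insert i S, ratio (R (D i)) (R (D' i)) (R (D'' i)) (y j)) /
                (insert i S).card| ^ α) := by
  classical
  have hq1 : Real.exp (-ε) < 1 := by simpa using hε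
  have hmix : ∀ j, ∃ s : PMF Y, ∀ y, (R (D'' j) y).toReal =
      Real.exp (-ε) * (R (D'' i) y).toReal + (1 - Real.exp (-ε)) * (s y).toReal := by
    intro j
    obtain ⟨s, hs⟩ := exists_mixture (R (D'' j)) (R (D'' i)) (q := ENNReal.ofReal (Real.exp (-ε)))
      (by simpa using hε) fun y ↦ by
        rw [← ENNReal.toReal_le_toReal (by finiteness [(R (D'' i)).apply_ne_top y])
          ((R (D'' j)).apply_ne_top y), ENNReal.toReal_mul,
          ENNReal.toReal_ofReal (Real.exp_nonneg _)]
        exact hR.exp_neg_mul_le _ _ _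
    refine ⟨s, fun y ↦ ?_⟩
    rw [hs, ENNReal.toReal_add (by finiteness [(R (D'' i)).apply_ne_top y])
      (by finiteness [s.apply_ne_top y]), ENNReal.toReal_mul, ENNReal.toReal_mul,
      ENNReal.toReal_sub_of_le (by simpa using hε.le) (by simp),
      ENNReal.toReal_ofReal (Real.exp_nonneg _), ENNReal.toReal_one]
  choose s hs using hmix
  set q := Real.exp (-ε) with hq
  have hq0 : 0 ≤ q := Real.exp_nonneg _
  set r := R (D'' i) with hr
  set A : Finset (Fin k) := Finset.univ.erase i with hA
  set μ : Finset (Fin k) → Fin k → PMF Y := fun S j ↦ if j ∈ insert i S then r else s j with hμ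
  have hμr : ∀ S, ∀ j ∈ insert i S, μ S j = r := fun S j hj ↦ if_pos hj
  set b : Finset (Fin k) → ℝ := fun S ↦ q ^ S.card * (1 - q) ^ (k - 1 - S.card) with hb
  have hb0 : ∀ S, 0 ≤ b S := fun S ↦ by
    have : 0 ≤ 1 - q := by linarith
    positivity
  have hAcard : A.card = k - 1 := by simp [hA]
  -- The joint mass of the `k` messages, with the density of the `i`-th one factored out.
  have hprod : ∀ z : Fin k → Y, (r (z i)).toReal * ∏ j ∈ A, (R (D'' j) (z j)).toReal =
      ∑ S ∈ A.powerset, b S * ∏ j, (μ S j (z j)).toReal := by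
    intro z
    simp only [hs]
    rw [Finset.prod_add, Finset.mul_sum]
    refine Finset.sum_congr rfl fun S hS ↦ ?_
    have hSA := Finset.mem_powerset.1 hS
    rw [← Finset.mul_prod_erase _ _ (Finset.mem_univ i), ← hA, ← Finset.prod_sdiff hSA,
      hμr S i (Finset.mem_insert_self i S)]
    have e1 : ∏ j ∈ S, (μ S j (z j)).toReal = ∏ j ∈ S, (r (z j)).toReal :=
      Finset.prod_congr rfl fun j hj ↦ by rw [hμr S j (Finset.mem_insert_of_mem hj)]
    have e2 : ∏ j ∈ A \ S, (μ S j (z j)).toReal = ∏ j ∈ A \ S, (s j (z j)).toReal := by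
      refine Finset.prod_congr rfl fun j hj ↦ ?_
      have hj' := Finset.mem_sdiff.1 hj
      have : j ∉ insert i S := by
        rw [Finset.mem_insert, not_or]
        exact ⟨Finset.ne_of_mem_erase hj'.1, hj'.2⟩
      rw [hμ]
      simp only [if_neg this]
    rw [e1, e2, Finset.prod_mul_distrib, Finset.prod_mul_distrib, Finset.prod_const,
      Finset.prod_const, Finset.card_sdiff_of_subset hSA, hAcard]
    simp only [hb]
    ring
  have hmass : ∀ (E : Fin k → X), (∀ j, j ≠ i → E j = D'' j) → ∀ h : Fin k → Y,
      (shuffleMechanism R k E h).toReal = (k.factorial : ℝ)⁻¹ * ∑ σ : Equiv.Perm (Fin k),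
        (R (E i) (h (σ i))).toReal * ∏ j ∈ A, (R (D'' j) (h (σ j))).toReal := by
    intro E hE h
    rw [shuffleMechanism_apply, ENNReal.toReal_mul, ENNReal.toReal_inv, ENNReal.toReal_natCast,
      ENNReal.toReal_sum fun σ _ ↦ ENNReal.prod_ne_top fun j _ ↦ (R (E j)).apply_ne_top _]
    congr 1
    refine Finset.sum_congr rfl fun σ _ ↦ ?_
    rw [ENNReal.toReal_prod, ← Finset.mul_prod_erase _ _ (Finset.mem_univ i)]
    congr 1
    refine Finset.prod_congr rfl fun j hj ↦ ?_
    rw [hE j (Finset.ne_of_mem_erase hj)]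
  refine ⟨μ, hμr, fun α hα ↦ ?_⟩
  set χ := ratio (R (D i)) (R (D' i)) r with hχ
  set w : Equiv.Perm (Fin k) × Finset (Fin k) → (Fin k → Y) → ℝ := fun a h ↦
    (k.factorial : ℝ)⁻¹ * (b a.2 * ∏ j, (μ a.2 j (h (a.1 j))).toReal) with hw
  set x : Equiv.Perm (Fin k) × Finset (Fin k) → (Fin k → Y) → ℝ := fun a h ↦
    (∑ j ∈ insert i a.2, χ (h (a.1 j))) / (insert i a.2).card with hx
  refine (ternaryChiDiv_le_sum (Finset.univ ×ˢ A.powerset) _ _ _ w x ?_ ?_ ?_ hα).trans_eq ?_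
  · intro a h
    have := hb0 a.2
    simp only [hw]
    positivity
  · intro h
    rw [hmass D'' (fun _ _ ↦ rfl), Finset.sum_product]
    simp only [hw, ← Finset.mul_sum]
    congr 1
    exact Finset.sum_congr rfl fun σ _ ↦ hprod fun j ↦ h (σ j)
  · intro h
    -- Per `S`, `sum_perm_mul_prod_eq_average` trades the average over `insert i S` for the ratio at
    -- `i`, and `mul_ratio` turns that ratio times `r` into the difference of the laws.
    rw [hmass D fun j hj ↦ (hD j hj).1.trans (hD j hj).2, hmass D' fun j hj ↦ (hD j hj).2,
      ← mul_sub, ← Finset.sum_sub_distrib, Finset.sum_product_right]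
    simp only [hw, hx, mul_assoc, ← Finset.mul_sum, ← sub_mul]
    congr 1
    have hS : ∀ S ∈ A.powerset, b S * ∑ σ : Equiv.Perm (Fin k), (∏ j, (μ S j (h (σ j))).toReal) *
        ((∑ j ∈ insert i S, χ (h (σ j))) / (insert i S).card) =
        ∑ σ : Equiv.Perm (Fin k), (b S * ∏ j, (μ S j (h (σ j))).toReal) * χ (h (σ i)) := by
      intro S _
      rw [← sum_perm_mul_prod_eq_average (fun j y ↦ (μ S j y).toReal) (insert i S)
        (Finset.mem_insert_self i S)
        (fun j hj ↦ by rw [hμr S j hj, hμr S i (Finset.mem_insert_self i S)]) χ h, Finset.mul_sum]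
      exact Finset.sum_congr rfl fun σ _ ↦ (mul_assoc _ _ _).symm
    rw [Finset.sum_congr rfl hS, Finset.sum_comm]
    refine Finset.sum_congr rfl fun σ _ ↦ ?_
    rw [← Finset.sum_mul, ← hprod fun j ↦ h (σ j), ← hR.mul_ratio _ _ (D'' i)]
    ring
  -- The substitution `y = h ∘ σ` shows that all permutations contribute equally.
  · have hterm : ∀ a ∈ (Finset.univ : Finset (Equiv.Perm (Fin k))) ×ˢ A.powerset,
        ∑' h, ENNReal.ofReal (w a h * |x a h| ^ α) =
          (k.factorial : ℝ≥0∞)⁻¹ * (ENNReal.ofReal (b a.2) * ∑' y : Fin k → Y,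
            ENNReal.ofReal ((∏ j, (μ a.2 j (y j)).toReal) *
              |(∑ j ∈ insert i a.2, χ (y j)) / (insert i a.2).card| ^ α)) := by
      intro a _
      rw [← ENNReal.tsum_mul_left, ← ENNReal.tsum_mul_left,
        ← (Equiv.arrowCongr a.1 (Equiv.refl Y)).tsum_eq]
      refine tsum_congr fun h ↦ ?_
      have hh : ∀ j, Equiv.arrowCongr a.1 (Equiv.refl Y) h (a.1 j) = h j := fun j ↦
        congrArg h (a.1.symm_apply_apply j)
      simp only [hh, hw, hx]
      rw [mul_assoc, mul_assoc, ENNReal.ofReal_mul (by positivity), ENNReal.ofReal_mul (hb0 _),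
        ENNReal.ofReal_inv_of_pos (by positivity), ENNReal.ofReal_natCast]
    rw [Finset.sum_congr rfl hterm, Finset.sum_product]
    simp only
    rw [Finset.sum_const, ← Finset.mul_sum, nsmul_eq_mul, Finset.card_univ, Fintype.card_perm,
      Fintype.card_fin, ← mul_assoc,
      ENNReal.mul_inv_cancel (by exact_mod_cast k.factorial_ne_zero) (by finiteness), one_mul]

/-! ### The bound for the shuffle mechanism -/

section Bound

variable {X Y : Type*} [Countable Y] {k : ℕ} {ε : ℝ} {R : X → PMF Y}

/-- If the moments of averages over at least `kbar k ε` messages are at most `F`, so is the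
divergence, up to the contribution of the rare event that fewer clients sample from `R (D'' i)`, on
which the ratio is only bounded by `exp ε - exp (-ε)`. -/
theorem IsLDP.ternaryChiDiv_shuffleMechanism_le (hk : 1 ≤ k) (hε : 0 < ε) (hR : IsLDP ε R)
    {D D' D'' : Fin k → X} {i : Fin k} (hD : ∀ j, j ≠ i → D j = D' j ∧ D' j = D'' j)
    {α F : ℝ} (hα : 1 ≤ α) (hF0 : 0 ≤ F)
    (hF : ∀ (T : Finset (Fin k)) (μ : Fin k → PMF Y), (∀ j ∈ T, μ j = R (D'' i)) →
      kbar k ε ≤ T.card →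
        ∑' y : Fin k → Y, ENNReal.ofReal ((∏ j, (μ j (y j)).toReal) *
          |(∑ j ∈ T, ratio (R (D i)) (R (D' i)) (R (D'' i)) (y j)) / T.card| ^ α) ≤
        ENNReal.ofReal F) :
    ternaryChiDiv α (shuffleMechanism R k D) (shuffleMechanism R k D')
        (shuffleMechanism R k D'') ≤
      ENNReal.ofReal (F + (Real.exp ε - Real.exp (-ε)) ^ α *
        Real.exp (-(((k : ℝ) - 1) / (8 * Real.exp ε)))) := by
  classical
  let _ : MeasurableSpace Y := ⊤
  obtain ⟨μ, hμ, hle⟩ := hR.ternaryChiDiv_shuffleMechanism_le_sum hε hD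
  set A : Finset (Fin k) := Finset.univ.erase i with hA
  have hAcard : A.card = k - 1 := by simp [hA]
  have hk1 : ((k - 1 : ℕ) : ℝ) = (k : ℝ) - 1 := by rw [Nat.cast_sub hk, Nat.cast_one]
  set q := Real.exp (-ε) with hq
  have hq0 : 0 ≤ q := Real.exp_nonneg _
  have hq1 : q ≤ 1 := by simpa [hq] using hε.le
  have h1q : 0 ≤ 1 - q := by linarith
  have hc : 0 ≤ Real.exp ε - q := sub_nonneg.2 (Real.exp_le_exp.2 (by linarith))
  set c := Real.exp ε - q with hcdef
  have hbound : ∀ S, ∑' y : Fin k → Y, ENNReal.ofReal ((∏ j, (μ S j (y j)).toReal) *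
      |(∑ j ∈ insert i S, ratio (R (D i)) (R (D' i)) (R (D'' i)) (y j)) /
        (insert i S).card| ^ α) ≤ ENNReal.ofReal (c ^ α) := by
    intro S
    rw [tsum_prod_mul_eq_lintegral]
    refine (lintegral_mono fun y ↦ ENNReal.ofReal_le_ofReal ?_).trans_eq
      (by rw [lintegral_const, measure_univ, mul_one])
    refine Real.rpow_le_rpow (abs_nonneg _) ?_ (by linarith)
    rw [abs_div, Nat.abs_cast]
    refine div_le_of_le_mul₀ (by positivity) hc ((Finset.abs_sum_le_sum_abs _ _).trans ?_)
    refine (Finset.sum_le_card_nsmul _ _ c fun j _ ↦ hR.abs_ratio_le hε.le _ _ _ _).trans_eq ?_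
    rw [nsmul_eq_mul, mul_comm]
  have hterm : ∀ S ∈ A.powerset,
      ENNReal.ofReal (q ^ S.card * (1 - q) ^ (k - 1 - S.card)) *
        ∑' y : Fin k → Y, ENNReal.ofReal ((∏ j, (μ S j (y j)).toReal) *
          |(∑ j ∈ insert i S, ratio (R (D i)) (R (D' i)) (R (D'' i)) (y j)) /
            (insert i S).card| ^ α) ≤
      ENNReal.ofReal (q ^ S.card * (1 - q) ^ (k - 1 - S.card) * F + c ^ α *
        if (S.card : ℝ) ≤ A.card * q / 2 then q ^ S.card * (1 - q) ^ (A.card - S.card) else 0) := by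
    intro S hS
    have hcard : (insert i S).card = S.card + 1 := Finset.card_insert_of_notMem fun hi ↦
      Finset.notMem_erase i _ (Finset.mem_powerset.1 hS hi)
    -- Either `#S` is at most half its mean, or the average is over at least `kbar k ε` messages.
    split_ifs with h
    · refine (mul_le_mul_right (hbound S) _).trans ?_
      rw [← ENNReal.ofReal_mul (by positivity), hAcard]
      refine ENNReal.ofReal_le_ofReal ?_
      rw [mul_comm (c ^ α)]
      exact le_add_of_nonneg_left (by positivity)
    · refine (mul_le_mul_right (hF (insert i S) (μ S) (hμ S) ?_) _).trans_eq ?_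
      · have hfloor : ⌊((k : ℝ) - 1) / (2 * Real.exp ε)⌋₊ ≤ S.card := by
          refine Nat.floor_le_of_le ?_
          rw [hAcard, hk1, hq, Real.exp_neg] at h
          refine le_of_eq_of_le ?_ (not_le.1 h).le
          field_simp
        rw [hcard, kbar]
        omega
      · rw [← ENNReal.ofReal_mul (by positivity), mul_zero, add_zero]
  refine ((hle α hα).trans (Finset.sum_le_sum hterm)).trans ?_
  rw [← ENNReal.ofReal_sum_of_nonneg]
  · refine ENNReal.ofReal_le_ofReal ?_
    rw [Finset.sum_add_distrib, ← Finset.sum_mul, ← Finset.mul_sum, ← Finset.sum_filter]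
    have h1 : ∑ S ∈ A.powerset, q ^ S.card * (1 - q) ^ (k - 1 - S.card) = 1 := by
      rw [← hAcard, Finset.sum_pow_mul_eq_add_pow]
      simp
    have h2 := sum_powerset_card_le_half_mean A hq0 hq1
    have he : (A.card : ℝ) * q / 8 = ((k : ℝ) - 1) / (8 * Real.exp ε) := by
      rw [hAcard, hk1, hq, Real.exp_neg]
      field_simp
    rw [he] at h2
    rw [h1, one_mul]
    gcongr
  · intro S _
    have : 0 ≤ c ^ α := by positivity
    split_ifs <;> positivity

end Bound

end ShuffleDP

theorem theorem4 {X Y : Type*} [Countable Y] (k : ℕ) (hk : 2 ≤ k) (ε₀ : ℝ) (hε₀ : 0 < ε₀)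
    (R : X → PMF Y) (hR : ShuffleDP.IsLDP ε₀ R) :
    ∃ ζ : ℝ → ℝ≥0,
      ShuffleDP.IsTernaryChiDP (ShuffleDP.shuffleMechanism R k) ζ ∧
      ∀ α : ℝ, 2 ≤ α →
        (ζ α : ℝ) ^ α ≤
          (if α = 2 then
            4 * ((Real.exp ε₀ - 1) ^ 2 / ((ShuffleDP.kbar k ε₀ : ℝ) * Real.exp ε₀))
          else
            α * Real.Gamma (α / 2) *
              (2 * (Real.exp (2 * ε₀) - 1) ^ 2 /
                ((ShuffleDP.kbar k ε₀ : ℝ) * Real.exp (2 * ε₀))) ^ (α / 2))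
          + (Real.exp ε₀ - Real.exp (-ε₀)) ^ α *
              Real.exp (-(((k : ℝ) - 1) / (8 * Real.exp ε₀))) := by
  let _ : MeasurableSpace Y := ⊤
  have hc : 0 < Real.exp ε₀ - Real.exp (-ε₀) := sub_pos.2 (Real.exp_lt_exp.2 (by linarith))
  have hkbar : (0 : ℝ) < ShuffleDP.kbar k ε₀ := by
    rw [ShuffleDP.kbar]
    positivity
  -- `F` and `B` are used for all `α ≥ 1`: the sub-Gaussian bound does not need `2 ≤ α`.
  set F : ℝ → ℝ := fun α ↦ if α = 2 then
      4 * ((Real.exp ε₀ - 1) ^ 2 / ((ShuffleDP.kbar k ε₀ : ℝ) * Real.exp ε₀))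
    else α * Real.Gamma (α / 2) * (2 * (Real.exp (2 * ε₀) - 1) ^ 2 /
      ((ShuffleDP.kbar k ε₀ : ℝ) * Real.exp (2 * ε₀))) ^ (α / 2) with hFdef
  set B : ℝ → ℝ := fun α ↦ F α + (Real.exp ε₀ - Real.exp (-ε₀)) ^ α *
    Real.exp (-(((k : ℝ) - 1) / (8 * Real.exp ε₀))) with hB
  have hF0 : ∀ α, 1 ≤ α → 0 ≤ F α := by
    intro α hα
    have : 0 < Real.Gamma (α / 2) := Real.Gamma_pos_of_pos (by linarith)
    simp only [hFdef]
    split_ifs <;> positivity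
  have hB0 : ∀ α, 1 ≤ α → 0 ≤ B α := fun α hα ↦ add_nonneg (hF0 α hα) (by positivity)
  have hζ : ∀ α, 1 ≤ α → ((B α ^ α⁻¹).toNNReal : ℝ) ^ α = B α := by
    intro α hα
    rw [Real.coe_toNNReal _ (Real.rpow_nonneg (hB0 α hα) _),
      Real.rpow_inv_rpow (hB0 α hα) (by linarith)]
  refine ⟨fun α ↦ (B α ^ α⁻¹).toNNReal, ?_, fun α hα ↦ (hζ α (by linarith)).le⟩
  rintro α hα D D' D'' ⟨i, hD⟩
  rw [hζ α hα]
  refine hR.ternaryChiDiv_shuffleMechanism_le (by omega) hε₀ hD hα (hF0 α hα) fun T μ hμ hT ↦ ?_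
  have hT' : (ShuffleDP.kbar k ε₀ : ℝ) ≤ T.card := by exact_mod_cast hT
  have hTn : T.Nonempty := Finset.card_pos.1 (by exact_mod_cast hkbar.trans_le hT')
  rw [ShuffleDP.tsum_prod_mul_eq_lintegral]
  have hν : ∀ j ∈ T, (μ j).toMeasure = (R (D'' i)).toMeasure := fun j hj ↦ by rw [hμ j hj]
  simp only [hFdef]
  split_ifs with h2
  · subst h2
    simp only [Real.rpow_two, sq_abs]
    rw [ShuffleDP.lintegral_sq_average_pi hν hTn (hR.memLp_ratio hε₀.le _ _ _) (measurable_of_countable _)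
      (hR.integral_ratio hε₀.le _ _ _)]
    refine ENNReal.ofReal_le_ofReal ?_
    calc _ ≤ 4 * ((Real.exp ε₀ - 1) ^ 2 / Real.exp ε₀) / ShuffleDP.kbar k ε₀ := by
          gcongr
          exact hR.integral_ratio_sq_le hε₀.le _ _ _
      _ = _ := by field_simp
  · refine (ShuffleDP.lintegral_abs_rpow_average_pi_le hν hTn (measurable_of_countable _) hc
      (hR.abs_ratio_le hε₀.le _ _ _) (hR.integral_ratio hε₀.le _ _ _) (by linarith)).trans
      (ENNReal.ofReal_le_ofReal ?_)
    have : 0 < Real.Gamma (α / 2) := Real.Gamma_pos_of_pos (by linarith)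
    have he : 2 * (Real.exp (2 * ε₀) - 1) ^ 2 / ((ShuffleDP.kbar k ε₀ : ℝ) * Real.exp (2 * ε₀)) =
        2 * (Real.exp ε₀ - Real.exp (-ε₀)) ^ 2 / ShuffleDP.kbar k ε₀ := by
      rw [two_mul ε₀, Real.exp_add, Real.exp_neg]
      field_simp
    rw [he]
    gcongr
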